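/- **Model.** Let $S$ be a finite set of servers. A job $K$ has a nonempty finite set of tasks; each task $k$ has a server $s_k\in S$, an activation delay $d_k\ge 0$, a processing time $t_k>0$, and a collection $f^K(k)$ of sets of tasks of $K$ (its feasibility sets). Task $k$ is feasible once its job has been injected and all tasks of at least one feasibility set of $k$ have been completed. It is active from the moment when it has been feasible for a time $d_k$, and it then waits in the queue of $s_k$ until its processing begins. A server processes one task at a time, without interruption, and is never idle while its queue is nonempty. Task $k$ is initial if $\emptyset\in f^K(k)$. The layer of a task is defined recursively: it is the least $m\ge 1$ such that some feasibility set of the task consists only of tasks of layer less than $m$ (so initial tasks have layer $1$). The job is doable if every task has a layer. The skeleton of $K$ is the directed graph on its tasks with an arc from $i$ to $k$ whenever $i$ belongs to some feasibility set of $k$. An adversary injects doable jobs at times $\ge 0$ into an initially empty system, with processing times bounded above and bounded away from $0$, and with bounded activation delays and bounded numbers of tasks per job. It is an $(r,b)$-adversary, where $0<r\le 1$ is the injection rate and $b>1$ the burstiness, if for every server $s$ and every time interval $I$ the total processing time of the tasks for $s$ in the jobs injected during $I$ is at most $r|I|+b$. Under the policy SAD-NFS, a server that starts a task chooses one with the smallest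 activation delay among the active tasks in its queue, breaking ties in favour of the smallest distance from source. The distance from source of a task is its layer minus $1$ or, alternatively, its distance in the skeleton from an initial task; the result holds for both. Remaining ties may be broken arbitrarily. A system is stable if there is a constant $M$ such that at all times every queue contains at most $M$ active tasks. **Proposition (instability of SAD-NFS).** There is a finite server set $S$ such that for every $r$ with $1/\sqrt2<r\le 1$ there are a $b>1$ and an $(r,b)$-adversary $\mathcal A$ on $S$ for which the system $(S,\text{SAD-NFS},\mathcal A)$ is unstable, under either notion of distance from source: it has at least one evolution, and in every evolution (that is, however the remaining ties are broken) the queue lengths are unbounded. -/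

import Mathlib

open scoped ENNReal

/-- A job over the server set `S`: finitely many tasks, each with a server, an activation delay and
a processing time, and a feasibility function assigning to every task its feasibility sets. -/
structure Job (S : Type) where
  /-- number of tasks -/
  length : ℕ
  length_pos : 0 < length
  server : Fin length → S
  delay : Fin length → ℝ
  delay_nonneg : ∀ k, 0 ≤ delay k
  procTime : Fin length → ℝ
  procTime_pos : ∀ k, 0 < procTime k
  /-- the feasibility function -/
  feas : Fin length → Set (Set (Fin length))

namespace Job

variable {S : Type}

/-- The tasks whose layer is at most `m`: `upToLayer 1` consists of the initial tasks, and
`upToLayer (m + 1)` of the tasks that are feasible once those of `upToLayer m` are completed. -/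
def upToLayer (K : Job S) : ℕ → Set (Fin K.length)
  | 0 => ∅
  | m + 1 => {k | ∃ A ∈ K.feas k, A ⊆ K.upToLayer m}

/-- Every task can be assigned a layer. -/
def Doable (K : Job S) : Prop := ∀ k, ∃ m, k ∈ K.upToLayer m

/-- The layer of a task (initial tasks have layer `1`). -/
noncomputable def layer (K : Job S) (k : Fin K.length) : ℕ := sInf {m | k ∈ K.upToLayer m}

/-- Distance from source, measured in layers. -/
noncomputable def layerDist (K : Job S) (k : Fin K.length) : ℕ := K.layer k - 1

/-- A task is initial if the empty set is one of its feasibility sets. -/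
def IsInitial (K : Job S) (k : Fin K.length) : Prop := ∅ ∈ K.feas k

/-- The skeleton: an arc from `i` to `k` whenever `k` depends on `i`. -/
def skeleton (K : Job S) : Digraph (Fin K.length) where
  Adj i k := ∃ A ∈ K.feas k, i ∈ A

/-- The end points of walks with `m` arcs in the skeleton that start at an initial task. -/
def reachedIn (K : Job S) : ℕ → Set (Fin K.length)
  | 0 => {k | K.IsInitial k}
  | m + 1 => {k | ∃ i ∈ K.reachedIn m, K.skeleton.Adj i k}

/-- Distance from source, measured as the distance in the skeleton from an initial task. -/
noncomputable def skeletonDist (K : Job S) (k : Fin K.length) : ℕ := sInf {m | k ∈ K.reachedIn m}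

/-- Total processing time that the job requires from server `s`. -/
def load [DecidableEq S] (K : Job S) (s : S) : ℝ :=
  ∑ k with K.server k = s, K.procTime k

end Job

/-- An adversary: a family of doable jobs with their injection times, such that processing times
are bounded and bounded away from zero, and activation delays and numbers of tasks are bounded. -/
structure Adversary (S : Type) where
  /-- index type of the injected jobs (equal jobs may be injected several times) -/
  Idx : Type
  job : Idx → Job S
  time : Idx → ℝ
  time_nonneg : ∀ j, 0 ≤ time j
  doable : ∀ j, (job j).Doable
  exists_Tmin : ∃ Tmin > 0, ∀ j k, Tmin ≤ (job j).procTime k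
  exists_Tmax : ∃ Tmax, ∀ j k, (job j).procTime k ≤ Tmax
  exists_Dmax : ∃ Dmax, ∀ j k, (job j).delay k ≤ Dmax
  exists_length_max : ∃ L, ∀ j, (job j).length ≤ L

namespace Adversary

variable {S : Type}

/-- The load injected for server `s` during the time interval `I`. -/
noncomputable def load [DecidableEq S] (A : Adversary S) (s : S) (I : Set ℝ) : ℝ≥0∞ :=
  ∑' j : {j : A.Idx // A.time j ∈ I}, ENNReal.ofReal ((A.job j.1).load s)

/-- `A` is an `(r, b)`-adversary. -/
def IsBounded [DecidableEq S] (A : Adversary S) (r b : ℝ) : Prop :=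
  0 < r ∧ r ≤ 1 ∧ 1 < b ∧
    ∀ (s : S) (a c : ℝ), a ≤ c → A.load s (Set.Icc a c) ≤ ENNReal.ofReal (r * (c - a) + b)

/-- All tasks of all injected jobs. -/
def Task (A : Adversary S) : Type := Σ j : A.Idx, Fin (A.job j).length

namespace Task

variable {A : Adversary S}

def server (x : A.Task) : S := (A.job x.1).server x.2

def delay (x : A.Task) : ℝ := (A.job x.1).delay x.2

def procTime (x : A.Task) : ℝ := (A.job x.1).procTime x.2

end Task

/-- A schedule gives the time at which each task starts being processed (`⊤` for never). -/
abbrev Schedule (A : Adversary S) : Type := A.Task → WithTop ℝ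

end Adversary

/-- A scheduling policy that compares tasks by fixed attributes of the tasks and their jobs:
`P x y` says that `x` has strictly higher priority than `y`. -/
abbrev Policy (S : Type) : Type :=
  (Σ K : Job S, Fin K.length) → (Σ K : Job S, Fin K.length) → Prop

/-- Smallest activation delay first, ties broken by the smallest distance from source, for a given
notion `dist` of distance from source. -/
def SADNFS {S : Type} (dist : (K : Job S) → Fin K.length → ℕ) : Policy S :=
  fun x y => x.1.delay x.2 < y.1.delay y.2 ∨
    (x.1.delay x.2 = y.1.delay y.2 ∧ dist x.1 x.2 < dist y.1 y.2)

namespace Adversary.Schedule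

variable {S : Type} {A : Adversary S}

/-- Task `x` has been completed by time `t` (processing is not interrupted). -/
def Completed (σ : A.Schedule) (x : A.Task) (t : ℝ) : Prop :=
  σ x + (x.procTime : WithTop ℝ) ≤ (t : WithTop ℝ)

/-- The job of `x` has been injected, and all tasks of some feasibility set of `x` have been
completed, by time `t`. -/
def Feasible (σ : A.Schedule) (x : A.Task) (t : ℝ) : Prop :=
  A.time x.1 ≤ t ∧ ∃ B ∈ (A.job x.1).feas x.2, ∀ k ∈ B, σ.Completed ⟨x.1, k⟩ t

/-- At time `t` the task `x` has been feasible for at least its activation delay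
(a task that is feasible at some time remains so). -/
def Activated (σ : A.Schedule) (x : A.Task) (t : ℝ) : Prop := σ.Feasible x (t - x.delay)

/-- The active tasks in the queue of server `s` at time `t`: those that have been activated and
whose processing has not begun. -/
def queue (σ : A.Schedule) (s : S) (t : ℝ) : Set A.Task :=
  {x | x.server = s ∧ σ.Activated x t ∧ (t : WithTop ℝ) < σ x}

/-- Server `s` is processing some task at time `t`. -/
def Busy (σ : A.Schedule) (s : S) (t : ℝ) : Prop :=
  ∃ x : A.Task, x.server = s ∧ σ x ≤ (t : WithTop ℝ) ∧ ¬ σ.Completed x t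

/-- `σ` is a possible evolution of the system with adversary `A` and policy `P`, starting with no
jobs: only activated tasks are processed, a server processes one task at a time and without
interruption, no server idles while its queue is nonempty, and whenever a server starts a task, no
task left in its queue has strictly higher priority. -/
structure IsExecution (P : Policy S) (σ : A.Schedule) : Prop where
  activated : ∀ (x : A.Task) (t : ℝ), σ x = t → σ.Activated x t
  exclusive : ∀ (x y : A.Task) (t : ℝ), x ≠ y → x.server = y.server → σ x = t → σ x ≤ σ y →
    σ x + (x.procTime : WithTop ℝ) ≤ σ y
  work_conserving : ∀ (s : S) (t : ℝ), (σ.queue s t).Nonempty → σ.Busy s t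
  priority : ∀ (x : A.Task) (t : ℝ), σ x = t → ∀ y ∈ σ.queue x.server t,
    ¬ P ⟨A.job y.1, y.2⟩ ⟨A.job x.1, x.2⟩

/-- The queue lengths stay bounded. -/
def IsStable (σ : A.Schedule) : Prop :=
  ∃ M : ℕ, ∀ (s : S) (t : ℝ), 0 ≤ t → (σ.queue s t).encard ≤ M

end Adversary.Schedule

/-- The system with policy `P` and adversary `A` is unstable, however the ties that `P` leaves open
are resolved: it can evolve, and no evolution keeps the queue lengths bounded. -/
def Unstable {S : Type} (P : Policy S) (A : Adversary S) : Prop :=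
  (∃ σ : A.Schedule, σ.IsExecution P) ∧ ∀ σ : A.Schedule, σ.IsExecution P → ¬ σ.IsStable

namespace Adversary.Schedule

variable {S : Type} {A : Adversary S}

/-! One fixed job on two servers, injected every 18 time units, is enough. Each server has an
initial task of length 1; its completion releases a short task of length 1 on the same server and a
long task of length 10 on the other. Each server receives load 12 per period, so the rate is 2/3 <
1/√2.

Only initial tasks have positive delay, so every released task precedes them. Hence long tasks are
never processed simultaneously, even on different servers (`long_disjoint`). Let the initial tasks
releasing two long tasks for different servers start at a and b, with a + 1 ≤ b. At time b the first
long task is already active on the server that starts an initial task, so it has been processed by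
then; the second is released only at b + 1. The long tasks therefore need 20 time units per period
of 18, and the backlog grows (`not_isStable`).

The case of a and b less than one unit apart is excluded by a parity invariant (`aligned_of_start`):
initial tasks start at even times on server 0 and at odd times on server 1. The short task extends
each initial task to a block of length 2 (`short_start`), which preserves the parity.

Instability uses only comparisons of unequal delays, so the notion of distance is irrelevant. An
evolution exists by greedy scheduling at integer times. -/

theorem Completed.mono {σ : A.Schedule} {x : A.Task} {t u : ℝ} (h : σ.Completed x t)
    (htu : t ≤ u) : σ.Completed x u :=
  le_trans h (WithTop.coe_le_coe.2 htu)

theorem Feasible.mono {σ : A.Schedule} {x : A.Task} {t u : ℝ} (h : σ.Feasible x t)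
    (htu : t ≤ u) : σ.Feasible x u := by
  obtain ⟨h1, B, hB, h2⟩ := h
  exact ⟨h1.trans htu, B, hB, fun k hk => (h2 k hk).mono htu⟩

theorem Activated.mono {σ : A.Schedule} {x : A.Task} {t u : ℝ} (h : σ.Activated x t)
    (htu : t ≤ u) : σ.Activated x u :=
  Feasible.mono h (by linarith)

/-! ### Existence of executions -/

section Greedy

/-- At time `n` an idle server with nonempty queue starts the task that `pick` selects. -/
def Picks (pick : Set A.Task → A.Task) (σ : A.Schedule) (n : ℕ) (x : A.Task) : Prop :=
  (σ.queue x.server n).Nonempty ∧ ¬ σ.Busy x.server n ∧ pick (σ.queue x.server n) = x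

open Classical in
/-- The greedy schedule, restricted to the starts before time `n`. -/
noncomputable def greedy (pick : Set A.Task → A.Task) : ℕ → A.Schedule
  | 0 => fun _ => ⊤
  | n + 1 => fun x => if Picks pick (greedy pick n) n x then ((n : ℝ) : WithTop ℝ)
      else greedy pick n x

open Classical in
/-- The schedule in which, at integer times, idle servers start tasks selected by `pick`. -/
noncomputable def greedyLimit (pick : Set A.Task → A.Task) : A.Schedule := fun x =>
  if h : ∃ k : ℕ, Picks pick (greedy pick k) k x then ((h.choose : ℝ) : WithTop ℝ) else ⊤

variable {pick : Set A.Task → A.Task} (hpick : ∀ Q : Set A.Task, Q.Nonempty → pick Q ∈ Q)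

include hpick

theorem Picks.mem_queue {σ : A.Schedule} {n : ℕ} {x : A.Task} (h : Picks pick σ n x) :
    x ∈ σ.queue x.server n := by
  have := hpick _ h.1
  rwa [h.2.2] at this

/-- A started task has left the queue, so it is never picked again and its start time is not
overwritten. -/
theorem greedy_eq_of_picks {k : ℕ} {x : A.Task} (h : Picks pick (greedy pick k) k x) {n : ℕ}
    (hn : k < n) : greedy pick n x = ((k : ℝ) : WithTop ℝ) := by
  induction n, hn using Nat.le_induction with
  | base => simp [greedy, h]
  | succ n hn ih =>
    have : ¬ Picks pick (greedy pick n) n x := fun h' => by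
      have h2 := (h'.mem_queue hpick).2.2
      rw [ih, WithTop.coe_lt_coe, Nat.cast_lt] at h2
      omega
    simp [greedy, this, ih]

omit hpick in
theorem greedy_cases (n : ℕ) (x : A.Task) : greedy pick n x = ⊤ ∨
    ∃ k < n, Picks pick (greedy pick k) k x ∧ greedy pick n x = ((k : ℝ) : WithTop ℝ) := by
  induction n with
  | zero => exact Or.inl rfl
  | succ n ih =>
    by_cases h : Picks pick (greedy pick n) n x
    · exact Or.inr ⟨n, n.lt_succ_self, h, by simp [greedy, h]⟩
    · have e : greedy pick (n + 1) x = greedy pick n x := by simp [greedy, h]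
      rw [e]
      exact ih.imp_right fun ⟨k, hk, h'⟩ => ⟨k, hk.trans n.lt_succ_self, h'⟩

theorem picks_unique {k l : ℕ} {x : A.Task} (hk : Picks pick (greedy pick k) k x)
    (hl : Picks pick (greedy pick l) l x) : k = l := by
  have h1 := greedy_eq_of_picks hpick hk (n := max k l + 1) (by omega)
  have h2 := greedy_eq_of_picks hpick hl (n := max k l + 1) (by omega)
  rw [h1, WithTop.coe_inj] at h2
  exact_mod_cast h2

theorem greedyLimit_eq {k : ℕ} {x : A.Task} (h : Picks pick (greedy pick k) k x) :
    greedyLimit pick x = ((k : ℝ) : WithTop ℝ) := by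
  have h' : ∃ k : ℕ, Picks pick (greedy pick k) k x := ⟨k, h⟩
  rw [greedyLimit, dif_pos h', picks_unique hpick h'.choose_spec h]

theorem exists_picks {x : A.Task} {t : ℝ} (h : greedyLimit pick x = t) :
    ∃ k : ℕ, Picks pick (greedy pick k) k x ∧ t = k := by
  by_cases h' : ∃ k : ℕ, Picks pick (greedy pick k) k x
  · obtain ⟨k, hk⟩ := h'
    rw [greedyLimit_eq hpick hk, WithTop.coe_inj] at h
    exact ⟨k, hk, h.symm⟩
  · simp [greedyLimit, h'] at h

/-- Before time `n` the greedy schedule and its restriction agree; after it the latter is `⊤`. -/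
theorem greedyLimit_cases (n : ℕ) (x : A.Task) :
    greedyLimit pick x = greedy pick n x ∨
      (greedy pick n x = ⊤ ∧ ((n : ℝ) : WithTop ℝ) ≤ greedyLimit pick x) := by
  rcases greedy_cases (pick := pick) n x with h | ⟨k, -, hk, h⟩
  · by_cases h' : ∃ k : ℕ, Picks pick (greedy pick k) k x
    · obtain ⟨k, hk⟩ := h'
      refine Or.inr ⟨h, ?_⟩
      rw [greedyLimit_eq hpick hk, WithTop.coe_le_coe, Nat.cast_le]
      by_contra! hlt
      rw [greedy_eq_of_picks hpick hk hlt] at h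
      exact WithTop.coe_ne_top h
    · exact Or.inl (by simp [greedyLimit, h', h])
  · exact Or.inl (by rw [greedyLimit_eq hpick hk, h])

/-- Processing times are positive, so a start at time `n` or later yields no completion by time `n`:
the choice at `n` depends on the past alone. -/
theorem greedyLimit_completed_iff {n : ℕ} {t : ℝ} (ht : t ≤ n) (x : A.Task) :
    (greedyLimit pick).Completed x t ↔ (greedy pick n).Completed x t := by
  rcases greedyLimit_cases hpick n x with h | ⟨h, h'⟩
  · simp [Completed, h]
  · simp only [Completed, h, top_add, top_le_iff, WithTop.coe_ne_top, iff_false]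
    intro hc
    have h1 : ((n : ℝ) : WithTop ℝ) + (x.procTime : WithTop ℝ) ≤ t := le_trans (by gcongr) hc
    have h2 : 0 < x.procTime := (A.job x.1).procTime_pos x.2
    rw [← WithTop.coe_add, WithTop.coe_le_coe] at h1
    linarith

theorem greedyLimit_activated_iff {n : ℕ} {t : ℝ} (ht : t ≤ n) (x : A.Task) :
    (greedyLimit pick).Activated x t ↔ (greedy pick n).Activated x t := by
  have h2 : 0 ≤ x.delay := (A.job x.1).delay_nonneg x.2
  have h3 : t - x.delay ≤ n := by linarith
  refine and_congr_right fun _ => exists_congr fun B => and_congr_right fun _ =>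
    forall₂_congr fun k _ => greedyLimit_completed_iff hpick h3 ⟨x.1, k⟩

/-- Only an inclusion: the task picked at time `n` is still queued in the restricted schedule. -/
theorem queue_greedyLimit_subset (n : ℕ) (s : S) :
    (greedyLimit pick).queue s n ⊆ (greedy pick n).queue s n := by
  rintro y ⟨h1, h2, h3⟩
  refine ⟨h1, (greedyLimit_activated_iff hpick le_rfl y).1 h2, ?_⟩
  rcases greedyLimit_cases hpick n y with h | ⟨h, -⟩
  · rwa [← h]
  · rw [h]; exact WithTop.coe_lt_top _

end Greedy

/-- If all times are integers and the priorities are well-founded, then the system can evolve. -/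
theorem exists_isExecution {P : Policy S}
    (wf : WellFounded fun x y : A.Task => P ⟨A.job x.1, x.2⟩ ⟨A.job y.1, y.2⟩)
    (htime : ∀ j, ∃ n : ℕ, A.time j = n) (hdelay : ∀ x : A.Task, ∃ n : ℕ, x.delay = n)
    (hproc : ∀ x : A.Task, ∃ n : ℕ, x.procTime = n) :
    ∃ σ : A.Schedule, σ.IsExecution P := by
  rcases isEmpty_or_nonempty A.Task with he | ⟨⟨x₀⟩⟩
  · exact ⟨fun _ => ⊤, ⟨fun x => he.elim x, fun x => he.elim x,
      fun _ _ ⟨x, _⟩ => he.elim x, fun x => he.elim x⟩⟩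
  have hex : ∀ Q : Set A.Task, ∃ x, Q.Nonempty →
      x ∈ Q ∧ ∀ y ∈ Q, ¬ P ⟨A.job y.1, y.2⟩ ⟨A.job x.1, x.2⟩ := fun Q => by
    by_cases hQ : Q.Nonempty
    · obtain ⟨x, hx⟩ := wf.has_min Q hQ
      exact ⟨x, fun _ => hx⟩
    · exact ⟨x₀, fun h => absurd h hQ⟩
  choose pick hp using hex
  have hpick : ∀ Q : Set A.Task, Q.Nonempty → pick Q ∈ Q := fun Q hQ => (hp Q hQ).1
  have hone : ∀ x : A.Task, 1 ≤ x.procTime := fun x => by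
    obtain ⟨p, hxp⟩ := hproc x
    have h2 : 0 < x.procTime := (A.job x.1).procTime_pos x.2
    rw [hxp] at h2 ⊢
    exact_mod_cast h2
  refine ⟨greedyLimit pick, ?_, ?_, ?_, ?_⟩
  · intro x t h
    obtain ⟨k, hk, rfl⟩ := exists_picks hpick h
    exact (greedyLimit_activated_iff hpick le_rfl x).2 (hk.mem_queue hpick).2.1
  · intro x y t hxy hs hx hle
    obtain ⟨k, hk, rfl⟩ := exists_picks hpick hx
    cases hy : greedyLimit pick y with
    | top => exact le_top
    | coe u =>
      obtain ⟨l, hl, rfl⟩ := exists_picks hpick hy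
      rw [hx, hy, WithTop.coe_le_coe, Nat.cast_le] at hle
      rcases hle.eq_or_lt with rfl | hlt
      · have h1 := hk.2.2
        rw [hs, hl.2.2] at h1
        exact absurd h1.symm hxy
      · by_contra hc
        refine hl.2.1 ⟨x, hs, ?_, ?_⟩
        · rw [greedy_eq_of_picks hpick hk hlt, WithTop.coe_le_coe]
          exact_mod_cast hle
        · rw [← greedyLimit_completed_iff hpick le_rfl]
          exact hc
  · rintro s t ⟨x, rfl, hact, hlt⟩
    obtain ⟨d, hd⟩ := hdelay x
    have ht : 0 ≤ t := by
      have h1 := hact.1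
      have h2 := A.time_nonneg x.1
      have h3 : (0 : ℝ) ≤ d := d.cast_nonneg
      rw [hd] at h1
      linarith
    -- All data are integers, so activations and completions occur only at integer times and the
    -- state at `t` is that at `⌊t⌋₊`.
    set n := ⌊t⌋₊ with hn
    have hnt : (n : ℝ) ≤ t := Nat.floor_le ht
    have htn : t < n + 1 := Nat.lt_floor_add_one t
    have hnat : ∀ m : ℕ, (m : ℝ) ≤ t → (m : ℝ) ≤ n := fun m hm => by
      exact_mod_cast Nat.le_floor hm
    have hcomp : ∀ y : A.Task, ∀ e : ℕ, (greedyLimit pick).Completed y (t - e) →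
        (greedyLimit pick).Completed y (n - e) := fun y e hy => by
      unfold Completed at hy ⊢
      cases hy' : greedyLimit pick y with
      | top => simp [hy'] at hy
      | coe u =>
        obtain ⟨l, hl, rfl⟩ := exists_picks hpick hy'
        obtain ⟨p, hyp⟩ := hproc y
        rw [hy', hyp, ← WithTop.coe_add, WithTop.coe_le_coe] at hy
        rw [hyp, ← WithTop.coe_add, WithTop.coe_le_coe]
        have := hnat (l + p + e) (by push_cast; linarith)
        push_cast at this
        linarith
    have hact' : (greedyLimit pick).Activated x n := by
      obtain ⟨h1, B, hB, h2⟩ := hact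
      rw [hd] at h1 h2
      unfold Activated
      rw [hd]
      refine ⟨?_, B, hB, fun k hk => hcomp _ _ (h2 k hk)⟩
      obtain ⟨a, ha⟩ := htime x.1
      rw [ha] at h1 ⊢
      have := hnat (a + d) (by push_cast; linarith)
      push_cast at this
      linarith
    have hq : x ∈ (greedy pick n).queue x.server n :=
      queue_greedyLimit_subset hpick n _
        ⟨rfl, hact', lt_of_le_of_lt (WithTop.coe_le_coe.2 hnt) hlt⟩
    by_cases hb : (greedy pick n).Busy x.server n
    · obtain ⟨y, hy1, hy2, hy3⟩ := hb
      refine ⟨y, hy1, ?_, fun h => hy3 ?_⟩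
      · rcases greedyLimit_cases hpick n y with h | ⟨h, -⟩
        · rw [h]
          exact hy2.trans (WithTop.coe_le_coe.2 hnt)
        · simp [h] at hy2
      · rw [← greedyLimit_completed_iff hpick le_rfl]
        simpa using hcomp y 0 (by simpa using h)
    · have hs : (pick ((greedy pick n).queue x.server n)).server = x.server := (hpick _ ⟨x, hq⟩).1
      have hpk : Picks pick (greedy pick n) n (pick ((greedy pick n).queue x.server n)) := by
        refine ⟨?_, ?_, ?_⟩ <;> rw [hs]
        exacts [⟨x, hq⟩, hb]
      refine ⟨_, hs, ?_, ?_⟩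
      · rw [greedyLimit_eq hpick hpk]
        exact WithTop.coe_le_coe.2 hnt
      · unfold Completed
        rw [greedyLimit_eq hpick hpk, ← WithTop.coe_add, WithTop.coe_le_coe]
        have := hone (pick ((greedy pick n).queue x.server n))
        linarith
  · intro x t h y hy
    obtain ⟨k, hk, rfl⟩ := exists_picks hpick h
    have h1 := (hp _ hk.1).2 y (queue_greedyLimit_subset hpick k _ hy)
    rwa [hk.2.2] at h1

/-! ### What triggers the start of a task -/

/-- A task that starts later than it is activated starts when its server completes a task. -/
theorem IsExecution.exists_completion {P : Policy S} {σ : A.Schedule} (hσ : σ.IsExecution P)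
    (hone : ∀ x : A.Task, 1 ≤ x.procTime) {x : A.Task} {t a : ℝ} (hx : σ x = t) (ha : a < t)
    (hact : σ.Activated x a) :
    ∃ (y : A.Task) (s : ℝ), y.server = x.server ∧ σ y = s ∧ s + y.procTime = t := by
  have key : ∀ u, a ≤ u → u < t → ∃ (y : A.Task) (s : ℝ), y.server = x.server ∧ σ y = s ∧
      s ≤ u ∧ u < s + y.procTime ∧ s + y.procTime ≤ t := fun u hau hut => by
    have hux : ((u : ℝ) : WithTop ℝ) < σ x := by rw [hx]; exact WithTop.coe_lt_coe.2 hut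
    obtain ⟨y, hy1, hy2, hy3⟩ :=
      hσ.work_conserving x.server u ⟨x, rfl, hact.mono hau, hux⟩
    have hxy : y ≠ x := by rintro rfl; exact absurd hy2 (not_le.2 hux)
    obtain ⟨s, hs⟩ := WithTop.ne_top_iff_exists.1 (ne_top_of_le_ne_top WithTop.coe_ne_top hy2)
    have h4 := hσ.exclusive y x s hxy hy1 hs.symm (hy2.trans hux.le)
    unfold Completed at hy3
    rw [← hs, ← WithTop.coe_add, WithTop.coe_le_coe, not_le] at hy3
    rw [← hs, WithTop.coe_le_coe] at hy2
    rw [← hs, ← WithTop.coe_add, hx, WithTop.coe_le_coe] at h4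
    exact ⟨y, s, hy1, hs.symm, hy2, hy3, h4⟩
  obtain ⟨y, s, hy1, hy2, hy3, hy4, hy5⟩ :=
    -- In the last unit before `t` at most one completion fits: a further task begun after it would
    -- end beyond `t`.
    key (max a (t - 1)) (le_max_left _ _) (max_lt ha (by linarith))
  rcases hy5.eq_or_lt with h | h
  · exact ⟨y, s, hy1, hy2, h⟩
  · obtain ⟨z, v, hz1, hz2, hz3, hz4, hz5⟩ :=
      key (s + y.procTime) ((le_max_left _ _).trans hy4.le) h
    have hyz : y ≠ z := by
      rintro rfl
      rw [hy2, WithTop.coe_inj] at hz2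
      subst hz2
      exact lt_irrefl _ hz4
    have hv : s ≤ v := by
      by_contra! hlt
      have := hσ.exclusive z y v hyz.symm (hz1.trans hy1.symm) hz2
        (by rw [hz2, hy2]; exact WithTop.coe_le_coe.2 hlt.le)
      rw [hz2, hy2, ← WithTop.coe_add, WithTop.coe_le_coe] at this
      have := hone y
      linarith
    have h6 := hσ.exclusive y z s hyz (hy1.trans hz1.symm) hy2
      (by rw [hz2, hy2]; exact WithTop.coe_le_coe.2 hv)
    rw [hz2, hy2, ← WithTop.coe_add, WithTop.coe_le_coe] at h6
    have := hone z
    have := le_max_right a (t - 1)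
    linarith

end Adversary.Schedule

/-! ### A Rybko–Stolyar network -/

namespace RybkoStolyar

/-- The task `0` of server `0` releases a short task on the same server and a long task on the
other one, and likewise for the task `3` of server `1`. -/
def job : Job (Fin 2) where
  length := 6
  length_pos := by norm_num
  server := ![0, 0, 1, 1, 1, 0]
  -- Positive delays give the initial tasks the lowest priority; 2 and 3 differ in parity, so the
  -- two servers start them at times of opposite parity.
  delay := ![2, 0, 0, 3, 0, 0]
  delay_nonneg k := by fin_cases k <;> simp
  procTime := ![1, 1, 10, 1, 1, 10]
  procTime_pos k := by fin_cases k <;> simp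
  feas := ![{∅}, {{0}}, {{0}}, {∅}, {{3}}, {{3}}]

theorem job_doable : job.Doable := fun k => by
  refine ⟨2, ?_⟩
  have h0 : (0 : Fin 6) ∈ job.upToLayer 1 := ⟨∅, rfl, Set.empty_subset _⟩
  have h3 : (3 : Fin 6) ∈ job.upToLayer 1 := ⟨∅, rfl, Set.empty_subset _⟩
  have h0' := Set.singleton_subset_iff.2 h0
  have h3' := Set.singleton_subset_iff.2 h3
  change Fin 6 at k
  fin_cases k
  exacts [⟨∅, rfl, Set.empty_subset _⟩, ⟨_, rfl, h0'⟩, ⟨_, rfl, h0'⟩,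
    ⟨∅, rfl, Set.empty_subset _⟩, ⟨_, rfl, h3'⟩, ⟨_, rfl, h3'⟩]

theorem job_load (s : Fin 2) : job.load s = 12 := by
  have h : job.load s =
      ∑ k : Fin 6, if job.server k = s then job.procTime k else 0 := Finset.sum_filter _ _
  rw [h, Fin.sum_univ_six]
  fin_cases s <;> simp [job] <;> norm_num

/-! ### Injection rate -/

/-- The adversary that injects the job every `18` time units. -/
def adversary : Adversary (Fin 2) where
  Idx := ℕ
  job _ := job
  time n := 18 * (n : ℝ)
  time_nonneg n := by positivity
  doable _ := job_doable
  exists_Tmin := ⟨1, one_pos, fun _ k => by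
    change Fin 6 at k
    fin_cases k <;> simp [job]⟩
  exists_Tmax := ⟨10, fun _ k => by
    change Fin 6 at k
    fin_cases k <;> simp [job]⟩
  exists_Dmax := ⟨3, fun _ k => by
    change Fin 6 at k
    fin_cases k <;> simp [job] <;> norm_num⟩
  exists_length_max := ⟨6, fun _ => le_rfl⟩

theorem adversary_isBounded {r : ℝ} (h : 2 / 3 ≤ r) (h1 : r ≤ 1) : adversary.IsBounded r 12 := by
  refine ⟨by linarith, h1, by norm_num, fun s a c hac => ?_⟩
  have hload : adversary.load s (Set.Icc a c) =
      ({n : ℕ | 18 * (n : ℝ) ∈ Set.Icc a c}.encard : ℝ≥0∞) * ENNReal.ofReal 12 := by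
    have h2 : adversary.load s (Set.Icc a c) =
        ∑' _ : {n : ℕ | 18 * (n : ℝ) ∈ Set.Icc a c}, ENNReal.ofReal (job.load s) := rfl
    rw [h2, job_load, ENNReal.tsum_const]
    rfl
  rw [hload]
  -- The bound `⌊c / 18⌋₊ ≤ c / 18` used below needs `0 ≤ c`.
  rcases lt_or_ge c 0 with hc | hc
  · have h3 : {n : ℕ | 18 * (n : ℝ) ∈ Set.Icc a c} = ∅ := by
      ext n
      simp only [Set.mem_ofPred_eq, Set.mem_Icc, Set.mem_empty_iff_false, iff_false, not_and, not_le]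
      intro _
      have : (0 : ℝ) ≤ n := n.cast_nonneg
      linarith
    rw [h3, Set.encard_empty]
    simp
  · have hsub : {n : ℕ | 18 * (n : ℝ) ∈ Set.Icc a c} ⊆
        (Finset.Icc ⌈a / 18⌉₊ ⌊c / 18⌋₊ : Finset ℕ) := fun n hn => by
      rw [Finset.coe_Icc]
      refine ⟨Nat.ceil_le.2 ?_, Nat.le_floor ?_⟩
      · linarith [hn.1]
      · linarith [hn.2]
    have hcard := Set.encard_le_encard hsub
    rw [Set.encard_coe_eq_coe_finsetCard, Nat.card_Icc] at hcard
    have hcard' : (({n : ℕ | 18 * (n : ℝ) ∈ Set.Icc a c}.encard : ℕ∞) : ℝ≥0∞) ≤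
        ((⌊c / 18⌋₊ + 1 - ⌈a / 18⌉₊ : ℕ) : ℝ≥0∞) := by exact_mod_cast hcard
    refine (mul_le_mul_left hcard' _).trans ?_
    rw [← ENNReal.ofReal_natCast, ← ENNReal.ofReal_mul (by positivity)]
    refine ENNReal.ofReal_le_ofReal ?_
    -- Multiplied by the load 12 this gives rate 2/3 and burstiness 12.
    have h5 : ((⌊c / 18⌋₊ + 1 - ⌈a / 18⌉₊ : ℕ) : ℝ) ≤ (c - a) / 18 + 1 := by
      have h6 : (⌊c / 18⌋₊ : ℝ) ≤ c / 18 := Nat.floor_le (by positivity)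
      have h7 : a / 18 ≤ ⌈a / 18⌉₊ := Nat.le_ceil _
      rcases le_total ⌈a / 18⌉₊ (⌊c / 18⌋₊ + 1) with h | h
      · rw [Nat.cast_sub h]
        push_cast
        linarith
      · rw [Nat.sub_eq_zero_of_le h]
        push_cast
        linarith
    have h8 : 2 / 3 * (c - a) ≤ r * (c - a) := mul_le_mul_of_nonneg_right h (by linarith)
    linarith

/-! ### Activation in the network -/

/-- The task `k` of the `n`-th job. -/
def task (n : ℕ) (k : Fin 6) : adversary.Task := ⟨n, k⟩

theorem exists_eq_task (x : adversary.Task) : ∃ n k, x = task n k := ⟨x.1, x.2, rfl⟩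

theorem task_inj {n m : ℕ} {k l : Fin 6} (h : task n k = task m l) : n = m ∧ k = l := by
  cases h
  exact ⟨rfl, rfl⟩

theorem task_server (n : ℕ) (k : Fin 6) :
    (task n k).server = (![0, 0, 1, 1, 1, 0] : Fin 6 → Fin 2) k := rfl

theorem task_delay (n : ℕ) (k : Fin 6) :
    (task n k).delay = (![2, 0, 0, 3, 0, 0] : Fin 6 → ℝ) k := rfl

theorem task_procTime (n : ℕ) (k : Fin 6) :
    (task n k).procTime = (![1, 1, 10, 1, 1, 10] : Fin 6 → ℝ) k := rfl

theorem one_le_procTime (x : adversary.Task) : 1 ≤ x.procTime := by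
  obtain ⟨n, k, rfl⟩ := exists_eq_task x
  rw [task_procTime]
  fin_cases k <;> simp

/-- The initial task on which the task `k` depends. -/
def pred : Fin 6 → Fin 6 := ![0, 0, 0, 3, 3, 3]

variable {σ : adversary.Schedule}

theorem activated_zero_iff {n : ℕ} {t : ℝ} : σ.Activated (task n 0) t ↔ 18 * (n : ℝ) + 2 ≤ t := by
  have h : σ.Activated (task n 0) t ↔ 18 * (n : ℝ) ≤ t - 2 ∧ ∃ B ∈ ({∅} : Set (Set (Fin 6))),
    ∀ k ∈ B, σ.Completed (task n k) (t - 2) := Iff.rfl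
  rw [h]
  simp [le_sub_iff_add_le]

theorem activated_three_iff {n : ℕ} {t : ℝ} :
    σ.Activated (task n 3) t ↔ 18 * (n : ℝ) + 3 ≤ t := by
  have h : σ.Activated (task n 3) t ↔ 18 * (n : ℝ) ≤ t - 3 ∧ ∃ B ∈ ({∅} : Set (Set (Fin 6))),
    ∀ k ∈ B, σ.Completed (task n k) (t - 3) := Iff.rfl
  rw [h]
  simp [le_sub_iff_add_le]

/-- Here and below `k ≠ pred k` says that `k` is not initial; such tasks have delay 0. -/
theorem activated_iff_completed_pred {n : ℕ} {k : Fin 6} (hk : k ≠ pred k) {t : ℝ} :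
    σ.Activated (task n k) t ↔ 18 * (n : ℝ) ≤ t ∧ σ.Completed (task n (pred k)) t := by
  have h : ∀ d i, (![2, 0, 0, 3, 0, 0] : Fin 6 → ℝ) k = d →
      (![{∅}, {{0}}, {{0}}, {∅}, {{3}}, {{3}}] : Fin 6 → Set (Set (Fin 6))) k = {{i}} →
      (σ.Activated (task n k) t ↔ 18 * (n : ℝ) ≤ t - d ∧ σ.Completed (task n i) (t - d)) := by
    intro d i hd hi
    have h : σ.Activated (task n k) t ↔
      18 * (n : ℝ) ≤ t - (![2, 0, 0, 3, 0, 0] : Fin 6 → ℝ) k ∧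
      ∃ B ∈ (![{∅}, {{0}}, {{0}}, {∅}, {{3}}, {{3}}] : Fin 6 → Set (Set (Fin 6))) k,
        ∀ l ∈ B, σ.Completed (task n l) (t - (![2, 0, 0, 3, 0, 0] : Fin 6 → ℝ) k) := Iff.rfl
    rw [h, hd, hi]
    simp
  rw [h 0 (pred k)]
  · simp
  · revert hk; fin_cases k <;> simp [pred]
  · revert hk; fin_cases k <;> simp [pred]

end RybkoStolyar

/-! ### Priority of released tasks over initial ones -/

namespace RybkoStolyar

variable {σ : adversary.Schedule} {dist : (K : Job (Fin 2)) → Fin K.length → ℕ}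

theorem completed_iff {x : adversary.Task} {s t : ℝ} (h : σ x = s) :
    σ.Completed x t ↔ s + x.procTime ≤ t := by
  rw [Adversary.Schedule.Completed, h, ← WithTop.coe_add, WithTop.coe_le_coe]

theorem procTime_pred (n : ℕ) (k : Fin 6) : (task n (pred k)).procTime = 1 := by
  rw [task_procTime]
  fin_cases k <;> simp [pred]

theorem exists_pred_start {n : ℕ} {k : Fin 6} (hk : k ≠ pred k) {t : ℝ}
    (h : σ.Activated (task n k) t) : ∃ p : ℝ, σ (task n (pred k)) = p ∧ p + 1 ≤ t := by
  have h1 := ((activated_iff_completed_pred hk).1 h).2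
  cases hp : σ (task n (pred k)) with
  | top => simp [Adversary.Schedule.Completed, hp] at h1
  | coe p =>
    rw [completed_iff hp, procTime_pred] at h1
    exact ⟨p, rfl, h1⟩

variable (hσ : σ.IsExecution (SADNFS dist))
include hσ

theorem nonneg_of_start {n : ℕ} {k : Fin 6} {t : ℝ} (h : σ (task n k) = t) :
    18 * (n : ℝ) ≤ t := by
  have h1 : 18 * (n : ℝ) ≤ t - (task n k).delay := (hσ.activated _ _ h).1
  have h2 : 0 ≤ (task n k).delay := job.delay_nonneg k
  linarith

theorem activated_of_pred_start {n : ℕ} {k : Fin 6} (hk : k ≠ pred k) {p t : ℝ}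
    (h : σ (task n (pred k)) = p) (ht : p + 1 ≤ t) : σ.Activated (task n k) t := by
  refine (activated_iff_completed_pred hk).2 ⟨?_, ?_⟩
  · have := nonneg_of_start hσ h
    linarith
  · rw [completed_iff h, procTime_pred]
    exact ht

theorem add_procTime_le {x y : adversary.Task} (hxy : x ≠ y) (hs : x.server = y.server) {s t : ℝ}
    (hx : σ x = s) (hy : σ y = t) (hst : s ≤ t) : s + x.procTime ≤ t := by
  have := hσ.exclusive x y s hxy hs hx (by rw [hx, hy]; exact WithTop.coe_le_coe.2 hst)
  rwa [hx, hy, ← WithTop.coe_add, WithTop.coe_le_coe] at this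

/-- When a server starts an initial task, all other kinds of tasks that have been activated on this
server have been started before. -/
theorem start_le_of_initial_start {n m : ℕ} {k : Fin 6} (hk : k ≠ pred k) {l : Fin 6}
    (hs : (task n k).server = (task m (pred l)).server) {t : ℝ} (ht : σ (task m (pred l)) = t)
    (hact : σ.Activated (task n k) t) : σ (task n k) ≤ t := by
  by_contra! hlt
  refine hσ.priority _ t ht (task n k) ⟨hs, hact, hlt⟩ (Or.inl ?_)
  change (![2, 0, 0, 3, 0, 0] : Fin 6 → ℝ) k < (![2, 0, 0, 3, 0, 0] : Fin 6 → ℝ) (pred l)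
  have h1 : (![2, 0, 0, 3, 0, 0] : Fin 6 → ℝ) k = 0 := by
    revert hk; fin_cases k <;> simp [pred]
  have h2 : (0 : ℝ) < (![2, 0, 0, 3, 0, 0] : Fin 6 → ℝ) (pred l) := by
    fin_cases l <;> simp [pred]
  rwa [h1]

/-- The short task released by an initial task starts as soon as the latter is completed, provided
that the initial tasks of the other server start at other times. -/
theorem short_start {f : Fin 6} (hf : f = 1 ∨ f = 4) {m : ℕ} {s : ℝ}
    (hs : σ (task m (pred f)) = s)
    (hgap : ∀ (n : ℕ) (p : ℝ), σ (task n (3 - pred f)) = p → p ≤ s → p + 1 ≤ s) :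
    σ (task m f) = ((s + 1 : ℝ) : WithTop ℝ) := by
  have hfp : f ≠ pred f := by clear hs hgap; revert hf; revert f; decide
  have hserv : (task m (pred f)).server = (task m f).server := by
    rw [task_server, task_server]; clear hgap hfp hs; revert hf; revert f; decide
  have hact := activated_of_pred_start hσ hfp hs le_rfl
  by_contra hne
  have hle : ((s + 1 : ℝ) : WithTop ℝ) ≤ σ (task m f) := by
    cases ht : σ (task m f) with
    | top => exact le_top
    | coe t =>
      obtain ⟨p, hp, hpt⟩ := exists_pred_start hfp (hσ.activated _ _ ht)
      rw [hs, WithTop.coe_inj] at hp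
      rw [hp]
      exact WithTop.coe_le_coe.2 hpt
  have hq : task m f ∈ σ.queue (task m f).server (s + 1) :=
    ⟨rfl, hact, lt_of_le_of_ne hle (Ne.symm hne)⟩
  obtain ⟨y, hy1, hy2, hy3⟩ := hσ.work_conserving _ _ ⟨_, hq⟩
  obtain ⟨n, k, rfl⟩ := exists_eq_task y
  obtain ⟨u, hu⟩ := WithTop.ne_top_iff_exists.1 (ne_top_of_le_ne_top WithTop.coe_ne_top hy2)
  have hu := hu.symm
  have hys : task n k ≠ task m (pred f) := by
    intro h
    rw [h, completed_iff hs, procTime_pred] at hy3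
    exact hy3 le_rfl
  rw [hu, WithTop.coe_le_coe] at hy2
  rw [completed_iff hu, not_le] at hy3
  -- The server is occupied by the initial task throughout `[s, s + 1)`, so a competitor can only
  -- start at `s + 1`.
  have hu' : u = s + 1 := by
    refine le_antisymm hy2 ?_
    rcases le_total u s with h | h
    · have := add_procTime_le hσ hys (hy1.trans hserv.symm) hu hs h
      linarith
    · have := add_procTime_le hσ hys.symm (hserv.trans hy1.symm) hs hu h
      rwa [procTime_pred] at this
  subst hu'
  by_cases hk : k = pred k
  · have hkf : k = pred f := by
      rw [task_server, task_server] at hy1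
      clear * - hf hk hy1
      revert hf hk hy1; revert f k; decide
    subst hkf
    have h := start_le_of_initial_start hσ hfp (hy1.symm) hu hact
    exact absurd h (not_le.2 hq.2.2)
  · obtain ⟨p, hp, hps⟩ := exists_pred_start hk (hσ.activated _ _ hu)
    -- The competitor was then active at time `s` already, and would have been started before the
    -- initial task. Since 0 and 3 are the initial tasks, `3 - pred f` is the other one.
    have hps' : p + 1 ≤ s := by
      rcases (show pred k = pred f ∨ pred k = 3 - pred f by
        clear * - ; revert f k; decide) with h | h
      · have hkf : k = f := by
          rw [task_server, task_server] at hy1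
          clear * - hf hk hy1 h
          revert hf hk hy1 h; revert f k; decide
        subst hkf
        have hnm : task n (pred k) ≠ task m (pred k) := fun h => by
          rw [(task_inj h).1] at hu
          exact hne hu
        have := add_procTime_le hσ hnm rfl hp hs (by linarith)
        rwa [procTime_pred] at this
      · exact hgap n p (h ▸ hp) (by linarith)
    have h := start_le_of_initial_start hσ hk (hy1.trans hserv.symm) hs
      (activated_of_pred_start hσ hk hp hps')
    rw [hu, WithTop.coe_le_coe] at h
    linarith

omit hσ

/-! ### The parity invariant -/

/-- The parity of the times at which tasks of kind `k` start. -/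
def offset : Fin 6 → ℤ := ![0, 1, 1, 1, 0, 0]

/-- `t` is an integer of the parity that belongs to the tasks of kind `k`. -/
def Aligned (k : Fin 6) (t : ℝ) : Prop := ∃ z : ℤ, t = z ∧ z % 2 = offset k

/-- Integers of opposite parity differ by at least 1, the length of an initial task. -/
theorem Aligned.add_one_le {k : Fin 6} {s t : ℝ} (hs : Aligned (pred k) s)
    (ht : Aligned (3 - pred k) t) (h : t ≤ s) : t + 1 ≤ s := by
  obtain ⟨z, rfl, hz⟩ := hs
  obtain ⟨w, rfl, hw⟩ := ht
  have h1 : z ≠ w := by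
    rintro rfl
    rw [hz] at hw
    clear * - hw
    revert hw; revert k; decide
  have h2 : w ≤ z := by exact_mod_cast h
  have h3 : w + 1 ≤ z := by omega
  exact_mod_cast h3

/-- Short and long tasks end at even times on server 0 and at odd times on server 1, exactly the
parities at which initial and long tasks start there. -/
theorem Aligned.add_procTime {j k : Fin 6} (hj : j ≠ pred j) (hk : k ≠ 1 ∧ k ≠ 4) {n m : ℕ}
    (hs : (task n j).server = (task m k).server) {s : ℝ} (h : Aligned j s) :
    Aligned k (s + (task n j).procTime) := by
  obtain ⟨z, rfl, hz⟩ := h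
  have hp : ((![1, 1, 10, 1, 1, 10] : Fin 6 → ℤ) j : ℝ) = (task n j).procTime := by
    rw [task_procTime]
    fin_cases j <;> simp
  refine ⟨z + (![1, 1, 10, 1, 1, 10] : Fin 6 → ℤ) j, by push_cast [hp]; rfl, ?_⟩
  rw [Int.add_emod, hz]
  rw [task_server, task_server] at hs
  clear * - hj hk hs
  revert hj hk hs
  revert j k
  decide

include hσ

/-- The tasks of each kind start at integer times of fixed parity. -/
theorem aligned_of_start {n : ℕ} {k : Fin 6} {t : ℝ} (h : σ (task n k) = t) : Aligned k t := by
  -- Every cause of a start at `t` started at least one unit earlier, so induction on an integer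
  -- bound for `t` suffices.
  obtain ⟨N, hN⟩ := exists_nat_gt t
  induction N generalizing n k t with
  | zero =>
    have := nonneg_of_start hσ h
    have : (0 : ℝ) ≤ n := n.cast_nonneg
    push_cast at hN
    linarith
  | succ N ih =>
    push_cast at hN
    have hshort : ∀ f : Fin 6, (f = 1 ∨ f = 4) → ∀ m s, σ (task m (pred f)) = ((s : ℝ) : WithTop ℝ) →
        s + 1 ≤ t → σ (task m f) = ((s + 1 : ℝ) : WithTop ℝ) := fun f hf m s hs hst =>
      short_start hσ hf hs fun n' p hp hps =>
        Aligned.add_one_le (ih hs (by linarith)) (ih hp (by linarith)) hps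
    have hsucc : ∀ p, k ≠ pred k → σ (task n (pred k)) = ((p : ℝ) : WithTop ℝ) → t = p + 1 →
        Aligned k t := fun p hk hp hpt => by
      obtain ⟨z, rfl, hz⟩ := ih hp (by linarith)
      refine ⟨z + 1, by push_cast; exact hpt, ?_⟩
      rw [Int.add_emod, hz]
      clear * - hk
      revert hk; revert k; decide
    by_cases hk1 : k = 1 ∨ k = 4
    · have hk : k ≠ pred k := by revert hk1; clear * -; revert k; decide
      obtain ⟨p, hp, hpt⟩ := exists_pred_start hk (hσ.activated _ _ h)
      have h1 := hshort k hk1 n p hp hpt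
      rw [h, WithTop.coe_inj] at h1
      exact hsucc p hk hp h1
    have hcause : ∀ a, a < t → σ.Activated (task n k) a → Aligned k t := fun a hat ha => by
      obtain ⟨y, s, hy1, hy2, rfl⟩ := hσ.exists_completion one_le_procTime h hat ha
      obtain ⟨m, j, rfl⟩ := exists_eq_task y
      have hone := one_le_procTime (task m j)
      by_cases hj : j = pred j
      -- The short task takes over the server when its initial task ends, so no other task can start
      -- then.
      · exfalso
        obtain ⟨f, hf, hfj⟩ : ∃ f : Fin 6, (f = 1 ∨ f = 4) ∧ j = pred f := by
          clear * - hj; revert hj; revert j; decide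
        subst hfj
        have hst := hshort f hf m s hy2 (by linarith)
        rw [procTime_pred] at h
        have hfs : (task m f).server = (task m (pred f)).server := by
          rw [task_server, task_server]; clear * - hf; revert hf; revert f; decide
        have hne : task m f ≠ task n k := fun he => hk1 ((task_inj he).2 ▸ hf)
        have h2 := add_procTime_le hσ hne (hfs.trans hy1) hst h le_rfl
        have := one_le_procTime (task m f)
        linarith
      · exact Aligned.add_procTime hj (not_or.1 hk1) hy1 (ih hy2 (by linarith))
    have hact := hσ.activated _ _ h
    by_cases hk : k = pred k
    · rcases (show k = 0 ∨ k = 3 by revert hk; clear * -; revert k; decide) with rfl | rfl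
      · rcases (activated_zero_iff.1 hact).eq_or_lt with he | hlt
        · exact ⟨18 * n + 2, by rw [← he]; push_cast; rfl, by simp [offset]; omega⟩
        · exact hcause _ hlt (activated_zero_iff.2 le_rfl)
      · rcases (activated_three_iff.1 hact).eq_or_lt with he | hlt
        · exact ⟨18 * n + 3, by rw [← he]; push_cast; rfl, by simp [offset]; omega⟩
        · exact hcause _ hlt (activated_three_iff.2 le_rfl)
    · obtain ⟨p, hp, hpt⟩ := exists_pred_start hk hact
      rcases hpt.eq_or_lt with he | hlt
      · exact hsucc p hk hp he.symm
      · exact hcause _ hlt (activated_of_pred_start hσ hk hp le_rfl)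

/-! ### Mutual exclusion of long tasks -/

/-- The two kinds of long tasks are never processed simultaneously if the initial task of the first
one starts earlier than that of the second one. -/
theorem long_add_le {n m : ℕ} {k l : Fin 6} (hkl : k = 2 ∧ l = 5 ∨ k = 5 ∧ l = 2) {a b s t : ℝ}
    (ha : σ (task n (pred k)) = a) (hb : σ (task m (pred l)) = b) (hab : a ≤ b)
    (hs : σ (task n k) = s) (ht : σ (task m l) = t) : s + 10 ≤ t := by
  have hk : k ≠ pred k ∧ l ≠ pred l ∧ (task n k).server = (task m (pred l)).server ∧
      pred k = 3 - pred l ∧ k ≠ pred l := by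
    rw [task_server, task_server]; rcases hkl with ⟨rfl, rfl⟩ | ⟨rfl, rfl⟩ <;> decide
  obtain ⟨hk1, hk2, hk3, hk4, hk5⟩ := hk
  have hk6 : (task n k).procTime = 10 := by
    rw [task_procTime]; rcases hkl with ⟨rfl, rfl⟩ | ⟨rfl, rfl⟩ <;> simp
  have hab' : a + 1 ≤ b :=
    Aligned.add_one_le (aligned_of_start hσ hb) (hk4 ▸ aligned_of_start hσ ha) hab
  -- At `b` the first long task is active on the server that starts an initial task, so it started
  -- earlier and, without interruption, is completed by `b`.
  have h1 := start_le_of_initial_start hσ hk1 hk3 hb (activated_of_pred_start hσ hk1 ha hab')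
  rw [hs, WithTop.coe_le_coe] at h1
  have h2 := add_procTime_le hσ (fun he => hk5 (task_inj he).2) hk3 hs hb h1
  obtain ⟨b', hb', hbt⟩ := exists_pred_start hk2 (hσ.activated _ _ ht)
  rw [hb, WithTop.coe_inj] at hb'
  linarith

/-- Long tasks are processed one at a time, even if they are on different servers. -/
theorem long_disjoint {n m : ℕ} {k l : Fin 6} (hk : k = 2 ∨ k = 5) (hl : l = 2 ∨ l = 5)
    (hne : task n k ≠ task m l) {s t : ℝ} (hs : σ (task n k) = s) (ht : σ (task m l) = t) :
    s + 10 ≤ t ∨ t + 10 ≤ s := by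
  by_cases hkl : k = l
  · subst hkl
    have hp : ∀ i, (task i k).procTime = 10 := fun i => by
      rw [task_procTime]; rcases hk with rfl | rfl <;> simp
    rcases le_total s t with h | h
    · have := add_procTime_le hσ hne rfl hs ht h
      rw [hp] at this
      exact Or.inl this
    · have := add_procTime_le hσ hne.symm rfl ht hs h
      rw [hp] at this
      exact Or.inr this
  · have hk' : k ≠ pred k := by rcases hk with rfl | rfl <;> decide
    have hl' : l ≠ pred l := by rcases hl with rfl | rfl <;> decide
    obtain ⟨a, ha, -⟩ := exists_pred_start hk' (hσ.activated _ _ hs)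
    obtain ⟨b, hb, -⟩ := exists_pred_start hl' (hσ.activated _ _ ht)
    have h1 : k = 2 ∧ l = 5 ∨ k = 5 ∧ l = 2 := by
      clear * - hk hl hkl; revert hk hl hkl; revert k l; decide
    rcases le_total a b with h | h
    · exact Or.inl (long_add_le hσ h1 ha hb h hs ht)
    · exact Or.inr (long_add_le hσ (by tauto) hb ha h ht hs)

end RybkoStolyar

/-! ### Counting long tasks -/

namespace RybkoStolyar

variable {σ : adversary.Schedule} {dist : (K : Job (Fin 2)) → Fin K.length → ℕ}

theorem card_le_of_queue {M : ℕ} {s : Fin 2} {t : ℝ} (hM : (σ.queue s t).encard ≤ M) (k : Fin 6)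
    {F : Finset ℕ} (hF : ∀ n ∈ F, task n k ∈ σ.queue s t) : F.card ≤ M := by
  have hinj : Function.Injective fun n => task n k := fun n m h => (task_inj h).1
  have h1 : (fun n => task n k) '' (F : Set ℕ) ⊆ σ.queue s t := by
    rintro _ ⟨n, hn, rfl⟩
    exact hF n hn
  have h2 := (Set.encard_le_encard h1).trans hM
  rw [hinj.encard_image, Set.encard_coe_eq_coe_finsetCard] at h2
  exact_mod_cast h2

variable (hσ : σ.IsExecution (SADNFS dist))
include hσ

/-- The long tasks that have started by time `t` number at most `t / 10 + 1`. -/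
theorem card_long_le (N : ℕ) {F : Finset (ℕ × Fin 6)}
    (hF : ∀ x ∈ F, (x.2 = 2 ∨ x.2 = 5) ∧ σ (task x.1 x.2) ≤ ((10 * N : ℝ) : WithTop ℝ)) :
    F.card ≤ N + 1 := by
  have hstart : ∀ x ∈ F, ∃ s : ℝ, σ (task x.1 x.2) = s := fun x hx =>
    (WithTop.ne_top_iff_exists.1 (ne_top_of_le_ne_top WithTop.coe_ne_top (hF x hx).2)).imp
      fun _ h => h.symm
  choose! start hst using hstart
  have hpos : ∀ x ∈ F, 0 ≤ start x := fun x hx =>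
    le_trans (by positivity) (nonneg_of_start hσ (hst x hx))
  rw [← Finset.card_range (N + 1)]
  -- Starts of distinct long tasks are at least 10 apart, so they fall into distinct windows of
  -- length 10.
  refine Finset.card_le_card_of_injOn (fun x => ⌊start x / 10⌋₊) (fun x hx => ?_) ?_
  · have h1 := (hF x hx).2
    rw [hst x hx, WithTop.coe_le_coe] at h1
    rw [Finset.coe_range, Set.mem_Iio, Nat.lt_succ_iff]
    exact Nat.floor_le_of_le (by linarith)
  · intro x hx y hy hxy
    by_contra hne
    have hne' : task x.1 x.2 ≠ task y.1 y.2 := fun h =>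
      hne (Prod.ext (task_inj h).1 (task_inj h).2)
    have hx1 := Nat.floor_le (div_nonneg (hpos x hx) (by norm_num : (0 : ℝ) ≤ 10))
    have hx2 := Nat.lt_floor_add_one (start x / 10)
    have hy1 := Nat.floor_le (div_nonneg (hpos y hy) (by norm_num : (0 : ℝ) ≤ 10))
    have hy2 := Nat.lt_floor_add_one (start y / 10)
    simp only at hxy
    rw [hxy] at hx1 hx2
    rcases long_disjoint hσ (hF x hx).1 (hF y hy).1 hne' (hst x hx) (hst y hy) with h | h <;>
      linarith

/-- With queues bounded by `M`, of the first `N` long tasks of each kind at most `2 * M` are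
unstarted at time `18 * N + 1`: `M` await their initial task and `M` are queued themselves. So at
least `2 * N - 4 * M` long tasks have started, more than mutual exclusion permits. -/
theorem not_isStable : ¬ σ.IsStable := by
  rintro ⟨M, hM⟩
  classical
  -- The factor 5 makes `T` a multiple of 10; with `q = 4 * M + 3` the final count reads `10 * q - 4
  -- * M ≤ 9 * q + 2`, that is, `3 ≤ 2`.
  set N : ℕ := 5 * (4 * M + 3) with hN
  set T : ℝ := 18 * N with hT
  have hT0 : 0 ≤ T := by positivity
  have hcount : ∀ k : Fin 6, k = 2 ∨ k = 5 →
      N ≤ 2 * M + ((Finset.range N).filter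
        fun n => σ (task n k) ≤ ((T + 1 : ℝ) : WithTop ℝ)).card := by
    intro k hk
    have hk' : k ≠ pred k := by rcases hk with rfl | rfl <;> decide
    have h1 : ((Finset.range N).filter
        fun n => (T : WithTop ℝ) < σ (task n (pred k))).card ≤ M := by
      refine card_le_of_queue (hM (task 0 (pred k)).server T hT0) (pred k) fun n hn => ?_
      rw [Finset.mem_filter, Finset.mem_range] at hn
      have hn1 : (n : ℝ) + 1 ≤ N := by exact_mod_cast hn.1
      refine ⟨rfl, ?_, hn.2⟩
      rcases hk with rfl | rfl
      · exact activated_zero_iff.2 (by linarith)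
      · exact activated_three_iff.2 (by linarith)
    have h2 : ((Finset.range N).filter fun n => σ (task n (pred k)) ≤ (T : WithTop ℝ) ∧
        ((T + 1 : ℝ) : WithTop ℝ) < σ (task n k)).card ≤ M := by
      refine card_le_of_queue (hM (task 0 k).server (T + 1) (by linarith)) k fun n hn => ?_
      rw [Finset.mem_filter] at hn
      obtain ⟨p, hp⟩ := WithTop.ne_top_iff_exists.1
        (ne_top_of_le_ne_top WithTop.coe_ne_top hn.2.1)
      have hpT := hn.2.1
      rw [← hp, WithTop.coe_le_coe] at hpT
      exact ⟨rfl, activated_of_pred_start hσ hk' hp.symm (by linarith), hn.2.2⟩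
    have h3 : Finset.range N ⊆ ((Finset.range N).filter
        fun n => (T : WithTop ℝ) < σ (task n (pred k))) ∪
        ((Finset.range N).filter fun n => σ (task n (pred k)) ≤ (T : WithTop ℝ) ∧
        ((T + 1 : ℝ) : WithTop ℝ) < σ (task n k)) ∪ ((Finset.range N).filter
        fun n => σ (task n k) ≤ ((T + 1 : ℝ) : WithTop ℝ)) := by
      intro n hn
      simp only [Finset.mem_union, Finset.mem_filter, hn, true_and]
      rcases lt_or_ge (T : WithTop ℝ) (σ (task n (pred k))) with h | h
      · exact Or.inl (Or.inl h)
      · rcases lt_or_ge ((T + 1 : ℝ) : WithTop ℝ) (σ (task n k)) with h' | h'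
        · exact Or.inl (Or.inr ⟨h, h'⟩)
        · exact Or.inr h'
    have h4 := Finset.card_le_card h3
    have h5 := h4.trans ((Finset.card_union_le _ _).trans
      (Nat.add_le_add_right (Finset.card_union_le _ _) _))
    rw [Finset.card_range] at h5
    omega
  have h2 := hcount 2 (Or.inl rfl)
  have h5 := hcount 5 (Or.inr rfl)
  set F := fun k : Fin 6 => (Finset.range N).filter
    fun n => σ (task n k) ≤ ((T + 1 : ℝ) : WithTop ℝ) with hF
  have hcard : ((F 2).map ⟨fun n => (n, (2 : Fin 6)), fun _ _ h => (Prod.ext_iff.1 h).1⟩ ∪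
      (F 5).map ⟨fun n => (n, (5 : Fin 6)), fun _ _ h => (Prod.ext_iff.1 h).1⟩).card ≤
      (9 * (4 * M + 3) + 1) + 1 := by
    refine card_long_le hσ _ fun x hx => ?_
    have hle : ((T + 1 : ℝ) : WithTop ℝ) ≤
        ((10 * (9 * (4 * M + 3) + 1 : ℕ) : ℝ) : WithTop ℝ) := by
      refine WithTop.coe_le_coe.2 ?_
      rw [hT, hN]
      push_cast
      linarith
    simp only [Finset.mem_union, Finset.mem_map, hF,
      Finset.mem_filter] at hx
    rcases hx with ⟨n, hn, rfl⟩ | ⟨n, hn, rfl⟩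
    exacts [⟨Or.inl rfl, hn.2.trans hle⟩, ⟨Or.inr rfl, hn.2.trans hle⟩]
  rw [Finset.card_union_of_disjoint, Finset.card_map, Finset.card_map] at hcard
  · change N ≤ 2 * M + (F 2).card at h2
    change N ≤ 2 * M + (F 5).card at h5
    omega
  · rw [Finset.disjoint_left]
    intro x hx hx'
    obtain ⟨n, -, rfl⟩ := Finset.mem_map.1 hx
    obtain ⟨m, -, h⟩ := Finset.mem_map.1 hx'
    exact absurd (Prod.ext_iff.1 h).2 (show (5 : Fin 6) ≠ 2 by decide)

/-! ### Existence of evolutions and conclusion -/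

omit hσ

/-- Priority depends only on which of the six kinds a task has, and a strict order on a finite set
is well-founded. -/
theorem wellFounded_SADNFS (dist : (K : Job (Fin 2)) → Fin K.length → ℕ) :
    WellFounded fun x y : adversary.Task =>
      SADNFS dist ⟨adversary.job x.1, x.2⟩ ⟨adversary.job y.1, y.2⟩ := by
  let R : Fin 6 → Fin 6 → Prop := fun k l => SADNFS dist ⟨job, k⟩ ⟨job, l⟩
  have htrans : IsTrans (Fin 6) R := ⟨fun k l m h1 h2 => by
    rcases h1 with h1 | ⟨h1, h1'⟩ <;> rcases h2 with h2 | ⟨h2, h2'⟩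
    · exact Or.inl (h1.trans h2)
    · exact Or.inl (h1.trans_eq h2)
    · exact Or.inl (h1.trans_lt h2)
    · exact Or.inr ⟨h1.trans h2, h1'.trans h2'⟩⟩
  have hirrefl : Std.Irrefl R := ⟨fun k h => by
    rcases h with h | ⟨-, h⟩
    · exact lt_irrefl _ h
    · exact lt_irrefl _ h⟩
  exact InvImage.wf (fun x : adversary.Task => (x.2 : Fin 6))
    (Finite.wellFounded_of_trans_of_irrefl R)

theorem unstable (dist : (K : Job (Fin 2)) → Fin K.length → ℕ) :
    Unstable (SADNFS dist) adversary := by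
  refine ⟨Adversary.Schedule.exists_isExecution (wellFounded_SADNFS dist)
    (fun n : ℕ => ⟨18 * n, by push_cast; rfl⟩) (fun x => ?_) (fun x => ?_),
    fun σ hσ => not_isStable hσ⟩
  · obtain ⟨n, k, rfl⟩ := exists_eq_task x
    refine ⟨(![2, 0, 0, 3, 0, 0] : Fin 6 → ℕ) k, ?_⟩
    rw [task_delay]
    fin_cases k <;> simp
  · obtain ⟨n, k, rfl⟩ := exists_eq_task x
    refine ⟨(![1, 1, 10, 1, 1, 10] : Fin 6 → ℕ) k, ?_⟩
    rw [task_procTime]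
    fin_cases k <;> simp

end RybkoStolyar

theorem mainTheorem5 :
    ∃ n : ℕ, ∀ r : ℝ, 1 / Real.sqrt 2 < r → r ≤ 1 →
      ∃ (b : ℝ) (A : Adversary (Fin n)), A.IsBounded r b ∧
        Unstable (SADNFS Job.layerDist) A ∧ Unstable (SADNFS Job.skeletonDist) A := by
  refine ⟨2, fun r hr hr1 => ⟨12, RybkoStolyar.adversary,
    RybkoStolyar.adversary_isBounded ?_ hr1, RybkoStolyar.unstable _, RybkoStolyar.unstable _⟩⟩
  have h2 : Real.sqrt 2 ≤ 3 / 2 := Real.sqrt_le_iff.2 (by norm_num)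
  have h3 : (2 / 3 : ℝ) ≤ 1 / Real.sqrt 2 := by
    rw [div_le_div_iff₀ (by norm_num) (by positivity)]
    linarith
  linarith
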